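/- Consider a clustered network with $n$ end-nodes divided into $m=n/k$ clusters of $k\ge 1$ end-nodes each, every cluster having one clusterhead (CH). Let $\lambda_e,\lambda_s,\lambda_c>0$. The source generates new versions of its information according to a Poisson process of rate $\lambda_e$; it sends its current version to the $m$ CHs according to a Poisson process of total rate $\lambda_s$; and each CH sends the version it holds to its own $k$ end-nodes according to a Poisson process of total rate $\lambda_c$. There is no other communication. A CH or end-node is called fresh at time $t$ if the version it holds is the version $\nu_s(t)$ of the source, and stale otherwise. Each sender (the source, or a CH), with total rate $\lambda$ and $r$ receivers, allocates its rate in one of two ways: * $DC_{\mathrm{noRC}}$ (traditional): each receiver is updated at rate $\lambda/r$ at all times; * $DC_{\mathrm{RC}}$ (rate-changing): fresh receivers are not updated, and each stale receiver is updated at rate $\lambda/(\text{number of currently stale receivers of this sender})$. Thus the vector of all versions is a continuous-time Markov chain with these transition rates. Initially no end-node is ahead of its CH and no CH is ahead of the source. A configuration $(A,B)$ means that the source uses $A$ and every CH uses $B$. For an end-node $i$ holding version $\nu_i(t)$, its long-term average freshness is $$\overline F_i=\limsup_{T\to\infty}\frac1T\,\mathbb E\left[\int_0^T \mathbb I_{\{\nu_i(t)=\nu_s(t)\}}\,dt\right].$$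 Put $a_s=\frac{\lambda_s}{\lambda_s+\lambda_e}$ and $a_c=\frac{\lambda_c}{\lambda_c+\lambda_e}$. Then every end-node $i$ has the following long-term average freshness: * for $(DC_{\mathrm{noRC}},DC_{\mathrm{noRC}})$: $\displaystyle \overline F_i=\frac{\lambda_s}{\lambda_s+m\lambda_e}\cdot\frac{\lambda_c}{\lambda_c+k\lambda_e}$; * for $(DC_{\mathrm{noRC}},DC_{\mathrm{RC}})$: $\displaystyle \overline F_i=\frac{\lambda_s}{\lambda_s+m\lambda_e}\cdot\frac{\lambda_c}{k\lambda_e}\left[1-a_c^k\right]$; * for $(DC_{\mathrm{RC}},DC_{\mathrm{noRC}})$: $\displaystyle \overline F_i=\frac{\lambda_s}{m\lambda_e}\left[1-a_s^m\right]\cdot\frac{\lambda_c}{\lambda_c+k\lambda_e}$; * for $(DC_{\mathrm{RC}},DC_{\mathrm{RC}})$: $\displaystyle \overline F_i=\frac{\lambda_s}{m\lambda_e}\left[1-a_s^m\right]\cdot\frac{\lambda_c}{k\lambda_e}\left[1-a_c^k\right]$. -/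

import Mathlib

open MeasureTheory ProbabilityTheory Filter Topology
open scoped NNReal

/-- `X` is a continuous-time Markov chain on the discrete state space `S`, with respect to the
filtration `ℱ`, with transition rates `Q` (`Q x y` is the rate of going from `x` to `y ≠ x`, and
`Q x x` is minus the total rate of leaving `x`): it is adapted, has right-continuous (step function)
paths, and satisfies the Markov property for a semigroup of transition probabilities `p t x`
whose derivative at time `0` is `Q`. -/
structure IsMarkovChainWithRates {Ω S : Type*} [mΩ : MeasurableSpace Ω]
    [MeasurableSpace S] [TopologicalSpace S]
    (P : Measure Ω) (ℱ : Filtration ℝ≥0 mΩ) (Q : S → S → ℝ) (X : ℝ≥0 → Ω → S) : Prop where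
  adapted : ∀ t, Measurable[ℱ t] (X t)
  rightCts : ∀ ω t, ContinuousWithinAt (fun s => X s ω) (Set.Ici t) t
  markov : ∃ p : ℝ≥0 → Kernel S S,
    (∀ t, IsMarkovKernel (p t)) ∧
    p 0 = Kernel.id ∧
    (∀ s t, p (s + t) = p t ∘ₖ p s) ∧
    (∀ x y, Tendsto (fun h : ℝ≥0 => ((p h x).real {y} - (p 0 x).real {y}) / (h : ℝ))
      (𝓝[>] 0) (𝓝 (Q x y))) ∧
    (∀ s t, ∀ B : Set S, MeasurableSet B →
      P⟦X (s + t) ⁻¹' B | ℱ s⟧ =ᵐ[P] fun ω => (p t (X s ω)).real B)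

namespace GossipNetwork

/-- The information held in a network of `m` clusters, each with a clusterhead and `k` end-nodes:
the version held by the source, by each clusterhead, and by each end-node of each cluster. -/
@[ext]
structure Versions (m k : ℕ) where
  source : ℕ
  head : Fin m → ℕ
  node : Fin m → Fin k → ℕ

namespace Versions

variable {m k : ℕ}

instance : MeasurableSpace (Versions m k) := ⊤
instance : DiscreteMeasurableSpace (Versions m k) := ⟨fun _ => trivial⟩
instance : TopologicalSpace (Versions m k) := ⊥
instance : DiscreteTopology (Versions m k) := ⟨rfl⟩

instance : Countable (Versions m k) := by
  refine Function.Injective.countable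
    (f := fun x : Versions m k => (x.source, x.head, x.node)) ?_
  intro x y h
  simp only [Prod.mk.injEq] at h
  exact Versions.ext h.1 h.2.1 h.2.2

/-- The source updates itself: a new version of the information appears. -/
def sourceUpdate (x : Versions m k) : Versions m k :=
  { x with source := x.source + 1 }

/-- Clusterhead `j` receives an update from the source. -/
def headUpdate (j : Fin m) (x : Versions m k) : Versions m k :=
  { x with head := Function.update x.head j x.source }

/-- End-node `i` of cluster `j` receives an update from its clusterhead. -/
def nodeUpdate (j : Fin m) (i : Fin k) (x : Versions m k) : Versions m k :=
  { x with node := Function.update x.node j (Function.update (x.node j) i (x.head j)) }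

/-- Information flows only downwards: no end-node is ahead of its clusterhead, and no
clusterhead is ahead of the source. -/
def Consistent (x : Versions m k) : Prop :=
  (∀ j, x.head j ≤ x.source) ∧ ∀ j i, x.node j i ≤ x.head j

/-- Binary freshness of end-node `i` of cluster `j`. -/
def freshness (j : Fin m) (i : Fin k) (x : Versions m k) : ℝ :=
  if x.node j i = x.source then 1 else 0

end Versions

/-- How a sender allocates its total update rate among its receivers (which form a disconnected
network): traditional gossip, or rate-changing gossip. -/
inductive Mode where
  | noRC
  | RC

/-- The rate at which a sender with total update rate `rate` updates receiver `a` out of `r`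
receivers. Without rate change it is always `rate / r`; with rate change, fresh receivers are
excluded and the total rate is shared equally by the stale ones. -/
noncomputable def linkRate {r : ℕ} (mode : Mode) (rate : ℝ) (fresh : Fin r → Prop)
    [DecidablePred fresh] (a : Fin r) : ℝ :=
  match mode with
  | .noRC => rate / r
  | .RC => if fresh a then 0 else rate / (Finset.univ.filter fun b => ¬ fresh b).card

/-- The indicator that `x = y`. -/
noncomputable def delta {S : Type*} (x y : S) : ℝ := ({x} : Set S).indicator (fun _ => 1) y

/-- The transition rates of the versions in a clustered network: self-updates of the source at
rate `lamE`, updates from the source to the clusterheads at total rate `lamS`, allocated according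
to `modeS`, and updates from each clusterhead to its `k` end-nodes at total rate `lamC`, allocated
according to `modeC`. Clusterheads and end-nodes are fresh when they hold the version of the
source. -/
noncomputable def transitionRate {m k : ℕ} (modeS modeC : Mode) (lamE lamS lamC : ℝ)
    (x y : Versions m k) : ℝ :=
  lamE * (delta x.sourceUpdate y - delta x y)
  + ∑ j : Fin m, linkRate modeS lamS (fun l => x.head l = x.source) j
      * (delta (x.headUpdate j) y - delta x y)
  + ∑ j : Fin m, ∑ i : Fin k, linkRate modeC lamC (fun l => x.node j l = x.source) i
      * (delta (x.nodeUpdate j i) y - delta x y)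

/-- `X` is the version process of a clustered network `(modeS, modeC)` of `m` clusters of size
`k`, started from any (possibly random) configuration in which information has only flowed
downwards. -/
structure IsClusteredNetwork {Ω : Type*} [mΩ : MeasurableSpace Ω] (P : Measure Ω)
    (ℱ : Filtration ℝ≥0 mΩ) {m k : ℕ} (modeS modeC : Mode) (lamE lamS lamC : ℝ)
    (X : ℝ≥0 → Ω → Versions m k) : Prop where
  init : ∀ᵐ ω ∂P, (X 0 ω).Consistent
  chain : IsMarkovChainWithRates P ℱ (transitionRate modeS modeC lamE lamS lamC) X

/-- The long-term average freshness of end-node `i` of cluster `j`. -/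
noncomputable def averageFreshness {Ω : Type*} [MeasurableSpace Ω] (P : Measure Ω) {m k : ℕ}
    (X : ℝ≥0 → Ω → Versions m k) (j : Fin m) (i : Fin k) : ℝ :=
  limsup (fun T : ℝ =>
    1 / T * ∫ ω, (∫ t in (0 : ℝ)..T, (X t.toNNReal ω).freshness j i) ∂P) atTop

end GossipNetwork

/-!
The average freshness is found by solving a Poisson equation, without stationary distributions or
ergodic theorems. If `G` is the generator of the version process and `F` is a bounded function
with `G F = g - c`, then Dynkin's formula
`𝔼 F(X_T) - 𝔼 F(X_0) = ∫₀ᵀ 𝔼 (G F)(X_t) dt`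
(`IsJumpSemigroup.integral_sub_eq_integral_jumpGenerator`) bounds the difference between `c` and
the expected average of `g` over `[0, T]` by a constant over `T`
(`tendsto_average_of_jumpGenerator_eq`). Dynkin's formula is available because the jump rates are
bounded and each state has finitely many successors, so the entrywise derivative of the
transition probabilities at time `0` controls the semigroup on bounded functions. The same formula
shows that the network stays consistent (`IsJumpSemigroup.ae_mem_of_invariant`).

On consistent states a new version makes every clusterhead and every end-node stale. Therefore the
set of fresh clusterheads evolves as a Markov chain on the subsets of `Fin m`, and the set of fresh
end-nodes of a cluster evolves in the same way on the subsets of `Fin k` while its clusterhead is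
fresh, and is empty otherwise (`jumpGenerator_freshHeads`, `jumpGenerator_freshNodes`). For this
single-layer chain, `exists_layerGenerator_eq` solves the Poisson equation for the freshness of one
receiver. Under rate change the solution has two parts: one depends only on the number of fresh
receivers and accounts for their proportion, the other shows that the chosen receiver is, on
average, as fresh as this proportion.

If `fS` and `fC` solve the equations of the source layer and of the cluster layer, with constants
`cS` and `cC`, then `fC + cC * fS` satisfies `G F = freshness - cC * cS`: the cluster layer
contributes the freshness of the end-node minus `cC` times the freshness of its clusterhead, and the
source layer replaces the latter by `cS` (`averageFreshness_eq`).
-/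

namespace GossipNetwork

/-! ### Markov chains with finitely many kinds of jump -/

section JumpChain

variable {ι S : Type*} [Fintype ι]

/-- The generator of the chain that, from the state `x`, jumps to `σ a x` at rate `r a x`,
for each of the finitely many kinds of jump `a`. -/
def jumpGenerator (r : ι → S → ℝ) (σ : ι → S → S) (f : S → ℝ) (x : S) : ℝ :=
  ∑ a, r a x * (f (σ a x) - f x)

/-- The transition probabilities `p` form a Markov semigroup whose derivative at time `0` is the
rate matrix of the jumps `σ a` occurring at rates `r a`. -/
structure IsJumpSemigroup [MeasurableSpace S] (r : ι → S → ℝ) (σ : ι → S → S)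
    (p : ℝ≥0 → Kernel S S) : Prop where
  isMarkov : ∀ t, IsMarkovKernel (p t)
  zero : p 0 = Kernel.id
  add : ∀ s t, p (s + t) = p t ∘ₖ p s
  deriv : ∀ x y, Tendsto (fun h : ℝ≥0 => ((p h x).real {y} - (p 0 x).real {y}) / (h : ℝ))
    (𝓝[>] 0) (𝓝 (∑ a, r a x * (delta (σ a x) y - delta x y)))

theorem delta_eq_ite [DecidableEq S] (x y : S) : delta x y = if y = x then 1 else 0 := by
  simp [delta, Set.indicator_apply]

theorem sum_delta_mul {A : Finset S} {z : S} (hz : z ∈ A) (f : S → ℝ) :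
    ∑ y ∈ A, delta z y * f y = f z := by
  classical
  simp [delta_eq_ite, hz]

theorem integrable_of_abs_le [MeasurableSpace S] [DiscreteMeasurableSpace S] [Countable S]
    {f : S → ℝ} {M : ℝ} (hf : ∀ x, |f x| ≤ M) (μ : Measure S) [IsFiniteMeasure μ] :
    Integrable f μ :=
  Integrable.of_bound (Measurable.of_discrete.aestronglyMeasurable) M
    (ae_of_all _ fun x => by simpa using hf x)

theorem abs_integral_le_of_abs_le [MeasurableSpace S] {f : S → ℝ} {M : ℝ}
    (hf : ∀ x, |f x| ≤ M) (μ : Measure S) [IsProbabilityMeasure μ] : |∫ x, f x ∂μ| ≤ M := by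
  simpa using norm_integral_le_of_norm_le_const (μ := μ)
    (ae_of_all _ fun x => (Real.norm_eq_abs (f x)).trans_le (hf x))

theorem abs_jumpGenerator_le {r : ι → S → ℝ} {σ : ι → S → S} {f : S → ℝ} {M R : ℝ}
    (hf : ∀ x, |f x| ≤ M) (hr : ∀ a x, |r a x| ≤ R) (x : S) :
    |jumpGenerator r σ f x| ≤ Fintype.card ι * (R * (2 * M)) := by
  refine (Finset.abs_sum_le_sum_abs _ _).trans ?_
  refine (Finset.sum_le_card_nsmul _ _ (R * (2 * M)) fun a _ => ?_).trans (by simp)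
  rw [abs_mul]
  have h1 := abs_sub (f (σ a x)) (f x)
  have h2 : 0 ≤ R := (abs_nonneg _).trans (hr a x)
  exact mul_le_mul (hr a x) (by linarith [hf (σ a x), hf x]) (abs_nonneg _) h2

namespace IsJumpSemigroup

variable [MeasurableSpace S] [DiscreteMeasurableSpace S]
  {r : ι → S → ℝ} {σ : ι → S → S} {p : ℝ≥0 → Kernel S S}

theorem zero_real (hp : IsJumpSemigroup r σ p) (x y : S) : (p 0 x).real {y} = delta x y := by
  classical
  rw [hp.zero, Kernel.id_apply, measureReal_def, Measure.dirac_apply' _ (by measurability),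
    delta_eq_ite]
  simp only [Set.indicator_apply, Set.mem_singleton_iff, eq_comm (a := x)]
  split_ifs <;> simp

theorem mul_le_real_add (hp : IsJumpSemigroup r σ p) (s t : ℝ≥0) (x : S) :
    (p s x).real {x} * (p t x).real {x} ≤ (p (s + t) x).real {x} := by
  have := hp.isMarkov
  rw [measureReal_def, measureReal_def, measureReal_def, ← ENNReal.toReal_mul]
  refine ENNReal.toReal_mono (measure_ne_top _ _) ?_
  rw [hp.add, Kernel.comp_apply' _ _ _ (by measurability)]
  refine le_trans ?_ (setLIntegral_le_lintegral {x} _)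
  rw [lintegral_singleton, mul_comm]

theorem pow_le_real_nsmul (hp : IsJumpSemigroup r σ p) (t : ℝ≥0) (x : S) (n : ℕ) :
    (p t x).real {x} ^ n ≤ (p (n * t) x).real {x} := by
  classical
  induction n with
  | zero => simp [hp.zero_real, delta_eq_ite]
  | succ n ih =>
    rw [pow_succ, show ((n + 1 : ℕ) : ℝ≥0) * t = n * t + t by push_cast; ring]
    exact (mul_le_mul_of_nonneg_right ih measureReal_nonneg).trans (hp.mul_le_real_add _ _ _)

/-- The chain leaves a state by time `h` with probability at most `h` times the exit rate: by
Bernoulli's inequality `1 - p_h(x, x) ≤ n (1 - p_{h/n}(x, x))`, and the right-hand side converges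
as `n → ∞`. -/
theorem one_sub_real_le (hp : IsJumpSemigroup r σ p) (hr : ∀ a x, 0 ≤ r a x) (h : ℝ≥0)
    (hh : 0 < h) (x : S) : 1 - (p h x).real {x} ≤ h * ∑ a, r a x := by
  classical
  have := hp.isMarkov
  have hlim : Tendsto (fun n : ℕ => h / (n + 1 : ℝ≥0)) atTop (𝓝[>] 0) := by
    refine tendsto_nhdsWithin_iff.2 ⟨?_, Eventually.of_forall fun n => ?_⟩
    · have : Tendsto (fun n : ℕ => (h : ℝ) / ((n : ℝ) + 1)) atTop (𝓝 0) := by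
        simpa [Function.comp_def] using
          (tendsto_const_div_atTop_nhds_zero_nat (h : ℝ)).comp (tendsto_add_atTop_nat 1)
      rw [← NNReal.tendsto_coe]
      simpa using this
    · exact div_pos hh (by positivity)
  have key := ((hp.deriv x x).comp hlim).const_mul (-(h : ℝ))
  have hle : -(h : ℝ) * ∑ a, r a x * (delta (σ a x) x - delta x x) ≤ h * ∑ a, r a x := by
    rw [neg_mul, ← mul_neg, ← Finset.sum_neg_distrib]
    gcongr with a
    simp only [delta_eq_ite]
    split_ifs <;> simp [hr a x]
  refine le_trans (ge_of_tendsto' key fun n => ?_) hle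
  have hb := one_add_mul_le_pow (R := ℝ) (a := (p (h / (n + 1)) x).real {x} - 1)
    (by linarith [measureReal_nonneg (μ := p (h / (n + 1)) x) (s := {x})]) (n + 1)
  have hpow := hp.pow_le_real_nsmul (h / (n + 1)) x (n + 1)
  have hmul : ((n + 1 : ℕ) : ℝ≥0) * (h / (n + 1)) = h := by
    push_cast
    field_simp
  rw [hmul] at hpow
  simp only [add_sub_cancel] at hb
  have hh' : (h : ℝ) ≠ 0 := by exact_mod_cast hh.ne'
  simp only [Function.comp_apply, hp.zero_real x x, delta_eq_ite, if_true]
  push_cast at hb ⊢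
  have hn : (n + 1 : ℝ) ≠ 0 := by positivity
  rw [show -(h : ℝ) * (((p (h / (n + 1)) x).real {x} - 1) / (h / (n + 1)))
    = -((n + 1) * ((p (h / (n + 1)) x).real {x} - 1)) by field_simp]
  linarith

variable [Countable S]

/-- A bounded function moves by `O(h)` in time `h`, uniformly in the starting state. -/
theorem abs_integral_sub_le (hp : IsJumpSemigroup r σ p) (hr : ∀ a x, 0 ≤ r a x) {R M : ℝ}
    (hR : ∀ a x, |r a x| ≤ R) {f : S → ℝ} (hf : ∀ x, |f x| ≤ M) (h : ℝ≥0) (hh : 0 < h) (x : S) :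
    |∫ y, f y ∂(p h x) - f x| ≤ 2 * M * (h * (Fintype.card ι * R)) := by
  have := hp.isMarkov
  have hM : 0 ≤ M := (abs_nonneg _).trans (hf x)
  have h1 : ∫ y, f y ∂(p h x) - f x = ∫ y, (f y - f x) ∂(p h x) := by
    rw [integral_sub (integrable_of_abs_le hf _) (integrable_const _)]
    simp
  have h2 : ∫ y, (f y - f x) ∂(p h x) = ∫ y in ({x} : Set S)ᶜ, (f y - f x) ∂(p h x) := by
    refine (setIntegral_eq_integral_of_forall_compl_eq_zero fun y hy => ?_).symm
    simp only [Set.mem_compl_iff, Set.mem_singleton_iff, not_not] at hy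
    simp [hy]
  have h3 : ‖∫ y in ({x} : Set S)ᶜ, (f y - f x) ∂(p h x)‖
      ≤ 2 * M * (p h x).real ({x} : Set S)ᶜ := by
    refine norm_setIntegral_le_of_norm_le_const (measure_lt_top _ _) fun y _ => ?_
    have := abs_sub (f y) (f x)
    rw [Real.norm_eq_abs]
    linarith [hf y, hf x]
  rw [h1, h2, ← Real.norm_eq_abs]
  refine h3.trans (mul_le_mul_of_nonneg_left ?_ (by positivity))
  rw [probReal_compl_eq_one_sub (by measurability)]
  refine (hp.one_sub_real_le hr h hh x).trans (mul_le_mul_of_nonneg_left ?_ h.2)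
  exact (Finset.sum_le_card_nsmul _ _ R fun a _ => (le_abs_self _).trans (hR a x)).trans (by simp)

/-- The derivative at time `0` of the semigroup, applied to a bounded function, is the generator.
Only finitely many states `A` can be reached from `x` in one jump; the probability of being
outside `A` at time `h` is `o(h)` because the rates out of `x` sum to zero over `A`. -/
theorem tendsto_integral_sub_div (hp : IsJumpSemigroup r σ p) {M : ℝ}
    {f : S → ℝ} (hf : ∀ x, |f x| ≤ M) (x : S) :
    Tendsto (fun h : ℝ≥0 => (∫ y, f y ∂(p h x) - f x) / (h : ℝ)) (𝓝[>] 0)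
      (𝓝 (jumpGenerator r σ f x)) := by
  classical
  have := hp.isMarkov
  set A : Finset S := insert x (Finset.univ.image fun a => σ a x) with hA
  have hx : x ∈ A := by simp [hA]
  have hσ : ∀ a, σ a x ∈ A := fun a => by simp [hA]
  have hsum : ∀ g : S → ℝ,
      ∑ y ∈ A, (∑ a, r a x * (delta (σ a x) y - delta x y)) * g y = jumpGenerator r σ g x := by
    intro g
    simp_rw [Finset.sum_mul, jumpGenerator]
    rw [Finset.sum_comm]
    refine Finset.sum_congr rfl fun a _ => ?_
    simp_rw [mul_assoc, ← Finset.mul_sum, sub_mul, Finset.sum_sub_distrib,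
      sum_delta_mul (hσ a), sum_delta_mul hx]
  have hlim : ∀ g : S → ℝ, Tendsto (fun h : ℝ≥0 =>
      ∑ y ∈ A, ((p h x).real {y} - (p 0 x).real {y}) / (h : ℝ) * g y) (𝓝[>] 0)
      (𝓝 (jumpGenerator r σ g x)) := by
    intro g
    rw [← hsum g]
    exact tendsto_finsetSum _ fun y _ => (hp.deriv x y).mul_const _
  have hsplit : ∀ (h : ℝ≥0) (g : S → ℝ),
      ∑ y ∈ A, ((p h x).real {y} - (p 0 x).real {y}) / (h : ℝ) * g y
      = (∑ y ∈ A, (p h x).real {y} * g y - g x) / (h : ℝ) := by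
    intro h g
    simp_rw [hp.zero_real, div_mul_eq_mul_div, ← Finset.sum_div, sub_mul, Finset.sum_sub_distrib,
      sum_delta_mul hx]
  -- The mass outside `A` is the part that the rates do not see; `hlim` for the constant `1` shows
  -- that it is `o(h)`.
  have hout : Tendsto (fun h : ℝ≥0 => (∫ y in (A : Set S)ᶜ, f y ∂(p h x)) / (h : ℝ)) (𝓝[>] 0)
      (𝓝 0) := by
    have h1 := (hlim fun _ => 1).const_mul (-M)
    have h0 : jumpGenerator r σ (fun _ => (1 : ℝ)) x = 0 := by simp [jumpGenerator]
    rw [h0, mul_zero] at h1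
    refine squeeze_zero_norm (fun h => ?_) h1
    rw [hsplit]
    have h2 : ‖∫ y in (A : Set S)ᶜ, f y ∂(p h x)‖ ≤ M * (p h x).real (A : Set S)ᶜ :=
      norm_setIntegral_le_of_norm_le_const (measure_lt_top _ _) fun y _ => hf y
    rw [probReal_compl_eq_one_sub A.measurableSet, ← sum_measureReal_singleton A] at h2
    rw [norm_div, Real.norm_of_nonneg h.coe_nonneg, ← mul_div_assoc]
    refine div_le_div_of_nonneg_right (h2.trans_eq ?_) h.2
    simp only [mul_one]
    ring
  have htot := (hlim f).add hout
  rw [add_zero] at htot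
  refine htot.congr fun h => ?_
  rw [hsplit, ← add_div,
    ← integral_add_compl (μ := p h x) A.measurableSet (integrable_of_abs_le hf _),
    setIntegral_finset A (integrable_of_abs_le hf _).integrableOn]
  simp only [smul_eq_mul]
  ring

variable {μ : ℝ≥0 → Measure S}

theorem integral_add_time (hp : IsJumpSemigroup r σ p) (hμ : ∀ t, IsProbabilityMeasure (μ t))
    (hadd : ∀ s t, μ (s + t) = (μ s).bind (p t)) {M : ℝ} {f : S → ℝ} (hf : ∀ x, |f x| ≤ M)
    (s t : ℝ≥0) : ∫ x, f x ∂(μ (s + t)) = ∫ x, ∫ y, f y ∂(p t x) ∂(μ s) := by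
  have := hp.isMarkov
  have hk : μ (s + t) = (p t ∘ₖ Kernel.const Unit (μ s)) () := by
    rw [hadd, Kernel.comp_apply, Kernel.const_apply]
  have h := integrable_of_abs_le hf (μ (s + t))
  rw [hk] at h ⊢
  rw [Kernel.integral_comp h, Kernel.const_apply]

theorem abs_integral_add_time_sub_le (hp : IsJumpSemigroup r σ p)
    (hr : ∀ a x, 0 ≤ r a x) {R M : ℝ} (hR : ∀ a x, |r a x| ≤ R)
    (hμ : ∀ t, IsProbabilityMeasure (μ t)) (hadd : ∀ s t, μ (s + t) = (μ s).bind (p t))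
    {f : S → ℝ} (hf : ∀ x, |f x| ≤ M) (s t : ℝ≥0) :
    |∫ x, f x ∂(μ (s + t)) - ∫ x, f x ∂(μ s)| ≤ 2 * M * (Fintype.card ι * R) * t := by
  have := hp.isMarkov
  rcases eq_zero_or_pos t with rfl | ht
  · simp
  rw [hp.integral_add_time hμ hadd hf, ← integral_sub
    (integrable_of_abs_le (fun x => abs_integral_le_of_abs_le hf (p t x)) _)
    (integrable_of_abs_le hf _)]
  refine abs_integral_le_of_abs_le (fun x => (hp.abs_integral_sub_le hr hR hf t ht x).trans_eq ?_) _
  ring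

theorem continuous_integral (hp : IsJumpSemigroup r σ p)
    (hr : ∀ a x, 0 ≤ r a x) {R M : ℝ} (hR : ∀ a x, |r a x| ≤ R)
    (hμ : ∀ t, IsProbabilityMeasure (μ t)) (hadd : ∀ s t, μ (s + t) = (μ s).bind (p t))
    {f : S → ℝ} (hf : ∀ x, |f x| ≤ M) : Continuous fun t => ∫ x, f x ∂(μ t) := by
  refine (LipschitzWith.of_dist_le_mul (K := (2 * M * (Fintype.card ι * R)).toNNReal)
    fun s t => ?_).continuous
  wlog hst : s ≤ t generalizing s t
  · rw [dist_comm, dist_comm s]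
    exact this t s (le_of_not_ge hst)
  obtain ⟨u, rfl⟩ := exists_add_of_le hst
  rw [dist_comm, Real.dist_eq]
  refine (hp.abs_integral_add_time_sub_le hr hR hμ hadd hf s u).trans ?_
  have : dist s (s + u) = u := by simp [NNReal.dist_eq]
  rw [this]
  exact mul_le_mul_of_nonneg_right (Real.le_coe_toNNReal _) u.2

theorem tendsto_integral_add_time (hp : IsJumpSemigroup r σ p)
    (hr : ∀ a x, 0 ≤ r a x) {R M : ℝ} (hR : ∀ a x, |r a x| ≤ R)
    (hμ : ∀ t, IsProbabilityMeasure (μ t)) (hadd : ∀ s t, μ (s + t) = (μ s).bind (p t))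
    {f : S → ℝ} (hf : ∀ x, |f x| ≤ M) (s : ℝ≥0) :
    Tendsto (fun h : ℝ≥0 => (∫ x, f x ∂(μ (s + h)) - ∫ x, f x ∂(μ s)) / (h : ℝ)) (𝓝[>] 0)
      (𝓝 (∫ x, jumpGenerator r σ f x ∂(μ s))) := by
  have := hp.isMarkov
  have h1 : Tendsto (fun h : ℝ≥0 => ∫ x, (∫ y, f y ∂(p h x) - f x) / (h : ℝ) ∂(μ s)) (𝓝[>] 0)
      (𝓝 (∫ x, jumpGenerator r σ f x ∂(μ s))) := by
    refine tendsto_integral_filter_of_dominated_convergence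
      (fun _ => 2 * M * (Fintype.card ι * R)) (Eventually.of_forall fun h =>
        Measurable.of_discrete.aestronglyMeasurable) ?_ (integrable_const _)
      (ae_of_all _ fun x => hp.tendsto_integral_sub_div hf x)
    filter_upwards [self_mem_nhdsWithin] with h hh
    refine ae_of_all _ fun x => ?_
    have hh' : (0 : ℝ) < h := hh
    rw [norm_div, Real.norm_of_nonneg hh'.le, div_le_iff₀ hh', Real.norm_eq_abs]
    exact (hp.abs_integral_sub_le hr hR hf h hh x).trans_eq (by ring)
  refine h1.congr fun h => ?_
  rw [integral_div, integral_sub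
    (integrable_of_abs_le (fun x => abs_integral_le_of_abs_le hf (p h x)) _)
    (integrable_of_abs_le hf _), hp.integral_add_time hμ hadd hf]

/-- **Dynkin's formula**: the expectation of a bounded function of the chain is the integral over
time of the expectation of its image under the generator. -/
theorem integral_sub_eq_integral_jumpGenerator (hp : IsJumpSemigroup r σ p)
    (hr : ∀ a x, 0 ≤ r a x) {R M : ℝ} (hR : ∀ a x, |r a x| ≤ R)
    (hμ : ∀ t, IsProbabilityMeasure (μ t)) (hadd : ∀ s t, μ (s + t) = (μ s).bind (p t))
    {f : S → ℝ} (hf : ∀ x, |f x| ≤ M) (T : ℝ≥0) :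
    ∫ t in (0 : ℝ)..T, ∫ x, jumpGenerator r σ f x ∂(μ t.toNNReal)
      = ∫ x, f x ∂(μ T) - ∫ x, f x ∂(μ 0) := by
  have hcont : ∀ {g : S → ℝ} {M' : ℝ}, (∀ x, |g x| ≤ M') →
      Continuous fun t : ℝ => ∫ x, g x ∂(μ t.toNNReal) := fun hg =>
    (hp.continuous_integral hr hR hμ hadd hg).comp continuous_real_toNNReal
  have h := intervalIntegral.integral_eq_sub_of_hasDeriv_right (a := 0) (b := T)
    (f := fun t : ℝ => ∫ x, f x ∂(μ t.toNNReal))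
    (f' := fun t : ℝ => ∫ x, jumpGenerator r σ f x ∂(μ t.toNNReal))
    (hcont hf).continuousOn (fun t ht => ?_)
    ((hcont (abs_jumpGenerator_le hf hR)).intervalIntegrable _ _)
  · simpa using h
  have ht0 : 0 ≤ t := by
    have := ht.1
    simp at this
    exact this.le
  rw [hasDerivWithinAt_iff_tendsto_slope' (by simp)]
  have hlim : Tendsto (fun u : ℝ => (u - t).toNNReal) (𝓝[>] t) (𝓝[>] 0) := by
    refine tendsto_nhdsWithin_iff.2 ⟨?_, ?_⟩
    · have : Continuous fun u : ℝ => (u - t).toNNReal := by fun_prop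
      simpa using (this.tendsto t).mono_left nhdsWithin_le_nhds
    · filter_upwards [self_mem_nhdsWithin] with u hu
      simpa using hu
  refine ((hp.tendsto_integral_add_time hr hR hμ hadd hf t.toNNReal).comp hlim).congr' ?_
  filter_upwards [self_mem_nhdsWithin] with u hu
  have hu' : 0 ≤ u - t := sub_nonneg.2 (le_of_lt hu)
  simp only [Function.comp_apply, slope_def_field]
  rw [← Real.toNNReal_add ht0 hu', Real.coe_toNNReal _ hu', add_sub_cancel]

/-- A set that the jumps never leave has full probability at all times if it has at time `0`. -/
theorem ae_mem_of_invariant (hp : IsJumpSemigroup r σ p)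
    (hr : ∀ a x, 0 ≤ r a x) {R : ℝ} (hR : ∀ a x, |r a x| ≤ R)
    (hμ : ∀ t, IsProbabilityMeasure (μ t)) (hadd : ∀ s t, μ (s + t) = (μ s).bind (p t))
    {C : Set S} (hC : ∀ a, ∀ x ∈ C, σ a x ∈ C) (h0 : ∀ᵐ x ∂(μ 0), x ∈ C) (t : ℝ≥0) :
    ∀ᵐ x ∂(μ t), x ∈ C := by
  have hCm : MeasurableSet C := .of_discrete
  have hb : ∀ x, |C.indicator (fun _ => (1 : ℝ)) x| ≤ 1 := fun x => by
    by_cases hx : x ∈ C <;> simp [hx]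
  have hD := hp.integral_sub_eq_integral_jumpGenerator hr hR hμ hadd hb t
  -- Jumps can only raise the indicator of `C`.
  have hnn : 0 ≤ ∫ s in (0 : ℝ)..t,
      ∫ x, jumpGenerator r σ (C.indicator fun _ => (1 : ℝ)) x ∂(μ s.toNNReal) := by
    refine intervalIntegral.integral_nonneg t.2 fun s _ => integral_nonneg fun x =>
      Finset.sum_nonneg fun a _ => mul_nonneg (hr a x) ?_
    by_cases hx : x ∈ C
    · simp [hx, hC a x hx]
    · simpa [hx] using Set.indicator_nonneg (fun _ _ => zero_le_one) _
  rw [hD] at hnn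
  simp only [integral_indicator_const _ hCm, smul_eq_mul, mul_one] at hnn
  have h1 : (μ 0).real C = 1 := by
    rw [measureReal_def, (mem_ae_iff_prob_eq_one hCm).1 h0, ENNReal.toReal_one]
  have h2 : (μ t).real C = 1 := le_antisymm measureReal_le_one (by linarith)
  refine (mem_ae_iff_prob_eq_one hCm).2 ?_
  rw [← ENNReal.ofReal_toReal (measure_ne_top (μ t) C), ← measureReal_def, h2, ENNReal.ofReal_one]

end IsJumpSemigroup

end JumpChain

/-! ### The fresh receivers of a single sender -/

section Layer

variable {r : ℕ}

theorem linkRate_nonneg (mode : Mode) {rate : ℝ} (h : 0 ≤ rate) (fresh : Fin r → Prop)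
    [DecidablePred fresh] (a : Fin r) : 0 ≤ linkRate mode rate fresh a := by
  cases mode <;> simp only [linkRate]
  · positivity
  · split_ifs <;> positivity

theorem linkRate_le (mode : Mode) {rate : ℝ} (h : 0 ≤ rate) (fresh : Fin r → Prop)
    [DecidablePred fresh] (a : Fin r) : linkRate mode rate fresh a ≤ rate := by
  have hdiv : ∀ n : ℕ, rate / n ≤ rate := fun n => by
    rcases n.eq_zero_or_pos with rfl | hn
    · simpa using h
    · exact div_le_self h (by exact_mod_cast hn)
  cases mode <;> simp only [linkRate]
  · exact hdiv r
  · split_ifs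
    · exact h
    · exact hdiv _

/-- The set of fresh receivers of a sender that is itself fresh is a Markov chain, and this is its
generator: all receivers become stale at rate `lamE`, and each receiver `l` becomes fresh at the
rate at which it is updated. -/
noncomputable def layerGenerator (mode : Mode) (lamE rate : ℝ) (f : Finset (Fin r) → ℝ)
    (S : Finset (Fin r)) : ℝ :=
  lamE * (f ∅ - f S) + ∑ l, linkRate mode rate (· ∈ S) l * (f (insert l S) - f S)

/-- The long-term probability for one of `r` receivers to be fresh, if its sender is always
fresh. -/
noncomputable def layerFreshness (mode : Mode) (lamE rate : ℝ) (r : ℕ) : ℝ :=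
  match mode with
  | .noRC => rate / (rate + r * lamE)
  | .RC => 1 / r * (rate / lamE) * (1 - (rate / (rate + lamE)) ^ r)

theorem layerGenerator_add (mode : Mode) (lamE rate : ℝ) (f g : Finset (Fin r) → ℝ)
    (S : Finset (Fin r)) : layerGenerator mode lamE rate (fun S => f S + g S) S
      = layerGenerator mode lamE rate f S + layerGenerator mode lamE rate g S := by
  have : ∀ l, linkRate mode rate (· ∈ S) l * (f (insert l S) + g (insert l S) - (f S + g S))
      = linkRate mode rate (· ∈ S) l * (f (insert l S) - f S)
        + linkRate mode rate (· ∈ S) l * (g (insert l S) - g S) := fun l => by ring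
  simp only [layerGenerator, this, Finset.sum_add_distrib]
  ring

theorem card_compl_add_card (S : Finset (Fin r)) : (Sᶜ.card : ℝ) + S.card = r := by
  have := S.card_compl_add_card
  rw [Fintype.card_fin] at this
  exact_mod_cast this

theorem sum_linkRate_RC_mul (rate : ℝ) (S : Finset (Fin r)) (g : Fin r → ℝ) :
    ∑ l, linkRate .RC rate (· ∈ S) l * g l = rate / Sᶜ.card * ∑ l ∈ Sᶜ, g l := by
  have hc : (Finset.univ.filter fun b => b ∉ S) = Sᶜ := by ext; simp
  simp only [linkRate, hc, Finset.mul_sum, ite_mul, zero_mul]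
  rw [Finset.sum_ite, Finset.sum_const_zero, zero_add, hc]

theorem card_compl_insert {S : Finset (Fin r)} {l : Fin r} (hl : l ∈ Sᶜ) :
    (insert l S)ᶜ.card + 1 = Sᶜ.card := by
  rw [Finset.compl_insert, Finset.card_erase_add_one hl]

theorem card_insert_of_mem_compl {S : Finset (Fin r)} {l : Fin r} (hl : l ∈ Sᶜ) :
    (insert l S).card = S.card + 1 :=
  Finset.card_insert_of_notMem (Finset.mem_compl.1 hl)

/-- A solution of the Poisson equation for the proportion of fresh receivers under rate change.
While some receiver is stale, the number of fresh ones grows by one at the total rate `rate`. This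
growth has `(rate / (rate + lamE)) ^ d`, with `d` the number of stale receivers, as an
eigenfunction; a multiple of it corrects the linear solution at the boundary `d = 0`, where the
growth stops. -/
theorem layerGenerator_RC_card (hr : 0 < r) {lamE rate : ℝ} (hE : 0 < lamE) (hrate : 0 < rate)
    (S : Finset (Fin r)) :
    layerGenerator .RC lamE rate (fun S => -(1 / (r * lamE))
        * (S.card - rate / lamE * (rate / (rate + lamE)) ^ Sᶜ.card)) S
      = S.card / r - layerFreshness .RC lamE rate r := by
  have hr' : (r : ℝ) ≠ 0 := by exact_mod_cast hr.ne'
  have hs : rate + lamE ≠ 0 := by positivity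
  rw [layerGenerator, sum_linkRate_RC_mul, layerFreshness]
  simp only [Finset.compl_empty, Finset.card_univ, Fintype.card_fin, Finset.card_empty]
  generalize ha : rate / (rate + lamE) = a
  have ha' : a * (rate + lamE) = rate := by rw [← ha]; field_simp
  rcases hd : Sᶜ.card with _ | d
  · have hc := card_compl_add_card S
    rw [hd] at hc
    simp only [Nat.cast_zero, zero_add] at hc
    rw [hc]
    simp only [Nat.cast_zero, div_zero, zero_mul, add_zero, pow_zero]
    field_simp
    ring
  · rw [Finset.sum_congr rfl fun l hl => by
      rw [card_insert_of_mem_compl hl,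
        show (insert l S)ᶜ.card = d by have := card_compl_insert hl; omega],
      Finset.sum_const, hd, nsmul_eq_mul, pow_succ]
    push_cast
    have : (d : ℝ) + 1 ≠ 0 := by positivity
    field_simp
    linear_combination (-(rate * a ^ d)) * ha'

/-- The radial part of the solution of the Poisson equation for the deviation of one receiver from
the proportion of fresh receivers, as a function of the number of stale receivers. -/
noncomputable def deviationWeight (lamE rate : ℝ) : ℕ → ℝ
  | 0 => 0
  | d + 1 => (rate * deviationWeight lamE rate d * d / (d + 1) - 1) / (lamE + rate)

/-- When a uniformly chosen stale receiver becomes fresh, the expected deviation of receiver `i`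
from the proportion of fresh receivers is multiplied by `d / (d + 1)`, where `d + 1` is the number
of stale receivers. Hence the generator maps the products of this deviation with functions of the
number of stale receivers to such products, and the recursion for `deviationWeight` makes the new
factor equal to `1`. -/
theorem layerGenerator_RC_deviation (hr : 0 < r) {lamE rate : ℝ} (hE : 0 < lamE)
    (hrate : 0 < rate) (i : Fin r) (S : Finset (Fin r)) :
    layerGenerator .RC lamE rate (fun S => ((if i ∈ S then 1 else 0) - S.card / r)
        * deviationWeight lamE rate Sᶜ.card) S
      = (if i ∈ S then 1 else 0) - S.card / r := by
  have hr' : (r : ℝ) ≠ 0 := by exact_mod_cast hr.ne'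
  have hs : lamE + rate ≠ 0 := by positivity
  rw [layerGenerator, sum_linkRate_RC_mul]
  have hc := card_compl_add_card S
  rcases hd : Sᶜ.card with _ | d
  · have hS : S = Finset.univ := by simpa using hd
    subst hS
    simp [hr']
  · rw [hd] at hc
    push_cast at hc
    have hd' : (d : ℝ) + 1 ≠ 0 := by positivity
    have hi : ∑ l ∈ Sᶜ, (if i ∈ insert l S then (1 : ℝ) else 0)
        = (d + 1) * (if i ∈ S then 1 else 0) + (1 - if i ∈ S then 1 else 0) := by
      by_cases h : i ∈ S
      · simp [h, hd]
      · have : ∀ l, (i ∈ insert l S) ↔ i = l := fun l => by simp [h]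
        simp [this, h]
    rw [Finset.sum_congr rfl fun l hl => by
      rw [card_insert_of_mem_compl hl,
        show (insert l S)ᶜ.card = d by have := card_compl_insert hl; omega],
      Finset.sum_sub_distrib, ← Finset.sum_mul, Finset.sum_sub_distrib, hi,
      Finset.sum_const, Finset.sum_const, hd]
    simp only [nsmul_eq_mul, Finset.notMem_empty, if_false, Finset.card_empty,
      deviationWeight]
    generalize (if i ∈ S then (1 : ℝ) else 0) = e
    generalize deviationWeight lamE rate d = w
    have hc' : (S.card : ℝ) = r - (d + 1) := by linarith
    push_cast
    rw [hc']
    field_simp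
    ring

/-- The Poisson equation of a single layer is solvable: the freshness of receiver `i` differs from
the constant `layerFreshness` by a function in the image of the generator. -/
theorem exists_layerGenerator_eq (mode : Mode) {lamE rate : ℝ} (hE : 0 < lamE)
    (hrate : 0 < rate) (i : Fin r) : ∃ f : Finset (Fin r) → ℝ, ∀ S,
      layerGenerator mode lamE rate f S
        = (if i ∈ S then 1 else 0) - layerFreshness mode lamE rate r := by
  have hr : 0 < r := i.pos
  have hr' : (r : ℝ) ≠ 0 := by exact_mod_cast hr.ne'
  cases mode with
  | noRC =>
    -- `lamE + rate / r` is the rate at which an indicator of freshness relaxes.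
    refine ⟨fun S => -(1 / (lamE + rate / r)) * (if i ∈ S then 1 else 0), fun S => ?_⟩
    have hs : rate + r * lamE ≠ 0 := by positivity
    have hs' : lamE + rate / r ≠ 0 := by positivity
    have hi : ∑ l, ((if i ∈ insert l S then (1 : ℝ) else 0) - if i ∈ S then 1 else 0)
        = 1 - if i ∈ S then 1 else 0 := by
      by_cases h : i ∈ S
      · simp [h]
      · have : ∀ l, (i ∈ insert l S) ↔ i = l := fun l => by simp [h]
        simp [this, h]
    simp only [layerGenerator, linkRate, layerFreshness, ← mul_sub, ← Finset.mul_sum, hi]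
    simp only [Finset.notMem_empty, if_false]
    generalize (if i ∈ S then (1 : ℝ) else 0) = e
    field_simp
    ring
  | RC =>
    refine ⟨fun S => -(1 / (r * lamE))
        * (S.card - rate / lamE * (rate / (rate + lamE)) ^ Sᶜ.card)
      + ((if i ∈ S then 1 else 0) - S.card / r) * deviationWeight lamE rate Sᶜ.card,
      fun S => ?_⟩
    rw [layerGenerator_add, layerGenerator_RC_card hr hE hrate,
      layerGenerator_RC_deviation hr hE hrate]
    ring

end Layer

/-! ### Long-run averages from the Poisson equation -/

section LongRunAverage

variable {Ω S : Type*} [mΩ : MeasurableSpace Ω] [MeasurableSpace S]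

/-- A step process with right-continuous paths is jointly measurable in time and chance: it is the
limit of its values at the next point of an ever finer grid. -/
theorem measurable_uncurry_of_rightCts [TopologicalSpace S] [DiscreteMeasurableSpace S]
    [DiscreteTopology S] {X : ℝ≥0 → Ω → S} (hX : ∀ t, Measurable (X t))
    (hc : ∀ ω t, ContinuousWithinAt (fun s => X s ω) (Set.Ici t) t) (g : S → ℝ) :
    Measurable fun z : ℝ≥0 × Ω => g (X z.1 z.2) := by
  -- `τ n t` is the first multiple of `1 / (n + 1)` strictly after `t`.
  let τ : ℕ → ℝ≥0 → ℝ≥0 := fun n t => (⌊(n + 1) * t⌋₊ + 1) / (n + 1)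
  refine measurable_of_tendsto_metrizable (f := fun n (z : ℝ≥0 × Ω) => g (X (τ n z.1) z.2))
    (fun n => ?_) (tendsto_pi_nhds.2 fun z => ?_)
  · have h1 : Measurable fun w : ℕ × Ω => g (X ((w.1 + 1) / (n + 1)) w.2) :=
      measurable_from_prod_countable_right fun q =>
        (Measurable.of_discrete (f := g)).comp (hX ((q + 1) / (n + 1)))
    exact h1.comp (f := fun z : ℝ≥0 × Ω => (⌊((n : ℝ≥0) + 1) * z.1⌋₊, z.2))
      ((Nat.measurable_floor.comp (measurable_fst.const_mul _)).prodMk measurable_snd)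
  · have hlow : ∀ n, z.1 ≤ τ n z.1 := fun n => by
      rw [le_div_iff₀ (by positivity), mul_comm]
      exact (Nat.lt_floor_add_one _).le
    have hup : ∀ n : ℕ, τ n z.1 ≤ z.1 + 1 / ((n : ℝ≥0) + 1) := fun n => by
      have hn : (n : ℝ≥0) + 1 ≠ 0 := by positivity
      rw [div_le_iff₀ (by positivity), add_mul z.1, one_div, inv_mul_cancel₀ hn, mul_comm z.1]
      gcongr
      exact Nat.floor_le (by positivity)
    have h0 : Tendsto (fun n : ℕ => z.1 + 1 / ((n : ℝ≥0) + 1)) atTop (𝓝 z.1) := by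
      simpa using (tendsto_one_div_add_atTop_nhds_zero_nat (𝕜 := ℝ≥0)).const_add z.1
    have hτ : Tendsto (fun n => τ n z.1) atTop (𝓝[≥] z.1) :=
      tendsto_nhdsWithin_iff.2 ⟨tendsto_of_tendsto_of_tendsto_of_le_of_le tendsto_const_nhds h0
        hlow hup, Eventually.of_forall hlow⟩
    exact ((continuous_of_discreteTopology (f := g)).tendsto _).comp ((hc z.2 z.1).tendsto.comp hτ)

variable {P : Measure Ω} [IsProbabilityMeasure P] {ℱ : Filtration ℝ≥0 mΩ} {X : ℝ≥0 → Ω → S}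

/-- The Markov property, in terms of the laws of the states. -/
theorem map_add_eq_bind [DiscreteMeasurableSpace S] {p : ℝ≥0 → Kernel S S}
    (hp : ∀ t, IsMarkovKernel (p t)) (hX : ∀ t, Measurable (X t)) {s t : ℝ≥0}
    (h : ∀ B : Set S, MeasurableSet B →
      P⟦X (s + t) ⁻¹' B | ℱ s⟧ =ᵐ[P] fun ω => (p t (X s ω)).real B) :
    P.map (X (s + t)) = (P.map (X s)).bind (p t) := by
  ext B hB
  have hpre := hX (s + t) hB
  rw [Measure.map_apply (hX _) hB, Measure.bind_apply hB (p t).aemeasurable,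
    lintegral_map Measurable.of_discrete (hX s)]
  have h1 : ∫ ω, (p t (X s ω)).real B ∂P = P.real (X (s + t) ⁻¹' B) := by
    rw [← integral_congr_ae (h B hB), integral_condExp (ℱ.le s), integral_indicator_const _ hpre]
    simp
  have h2 : ∫ ω, (p t (X s ω)).real B ∂P = (∫⁻ ω, p t (X s ω) B ∂P).toReal := by
    simp only [measureReal_def]
    refine integral_toReal ?_ (ae_of_all _ fun ω => measure_lt_top _ _)
    exact ((p t).measurable_coe hB |>.comp (hX s)).aemeasurable
  rw [h1, measureReal_def] at h2
  refine (ENNReal.toReal_eq_toReal_iff' (measure_ne_top _ _) ?_).1 h2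
  refine ne_top_of_le_ne_top ENNReal.one_ne_top ?_
  calc ∫⁻ ω, p t (X s ω) B ∂P ≤ ∫⁻ _, 1 ∂P := lintegral_mono fun _ => prob_le_one
    _ = 1 := by simp

/-- A bounded solution `f` of the Poisson equation `G f = g - c`, on an invariant set that carries
the initial state, shows that the time averages of `g` have expectations converging to `c`: by
Dynkin's formula they differ from `c` by `(𝔼 f(X_T) - 𝔼 f(X_0)) / T`. -/
theorem tendsto_average_of_jumpGenerator_eq [TopologicalSpace S] [DiscreteMeasurableSpace S]
    [DiscreteTopology S] [Countable S] {ι : Type*} [Fintype ι] {r : ι → S → ℝ}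
    {σ : ι → S → S} {R : ℝ} (hr : ∀ a x, 0 ≤ r a x) (hR : ∀ a x, |r a x| ≤ R)
    (hX : IsMarkovChainWithRates P ℱ
      (fun x y => ∑ a, r a x * (delta (σ a x) y - delta x y)) X)
    {C : Set S} (hC : ∀ a, ∀ x ∈ C, σ a x ∈ C) (h0 : ∀ᵐ ω ∂P, X 0 ω ∈ C)
    {f g : S → ℝ} {M M' c : ℝ} (hf : ∀ x, |f x| ≤ M) (hg : ∀ x, |g x| ≤ M')
    (hfg : ∀ x ∈ C, jumpGenerator r σ f x = g x - c) :
    Tendsto (fun T : ℝ => 1 / T * ∫ ω, (∫ t in (0 : ℝ)..T, g (X t.toNNReal ω)) ∂P) atTop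
      (𝓝 c) := by
  obtain ⟨p, hpm, hp0, hpadd, hpd, hpX⟩ := hX.markov
  have hp : IsJumpSemigroup r σ p := ⟨hpm, hp0, hpadd, hpd⟩
  have hXm : ∀ t, Measurable (X t) := fun t => (hX.adapted t).mono (ℱ.le t) le_rfl
  set μ : ℝ≥0 → Measure S := fun t => P.map (X t) with hμdef
  have hμ : ∀ t, IsProbabilityMeasure (μ t) := fun t =>
    Measure.isProbabilityMeasure_map (hXm t).aemeasurable
  have hadd : ∀ s t, μ (s + t) = (μ s).bind (p t) := fun s t =>
    map_add_eq_bind hpm hXm (hpX s t)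
  have h0' : ∀ᵐ x ∂(μ 0), x ∈ C :=
    (ae_map_iff (hXm 0).aemeasurable .of_discrete).2 h0
  have hCt := hp.ae_mem_of_invariant hr hR hμ hadd hC h0'
  have hGf : ∀ t, ∫ x, jumpGenerator r σ f x ∂(μ t) = ∫ ω, g (X t ω) ∂P - c := fun t => by
    rw [integral_congr_ae ((hCt t).mono hfg), integral_sub (integrable_of_abs_le hg _)
      (integrable_const _), hμdef, integral_map (hXm t).aemeasurable
      Measurable.of_discrete.aestronglyMeasurable]
    have := hμ t
    simp
  have hcont : Continuous fun t : ℝ => ∫ ω, g (X t.toNNReal ω) ∂P := by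
    have h := (hp.continuous_integral hr hR hμ hadd hg).comp continuous_real_toNNReal
    refine h.congr fun t => ?_
    exact integral_map (hXm _).aemeasurable Measurable.of_discrete.aestronglyMeasurable
  have hswap : ∀ T : ℝ, 0 < T → ∫ ω, (∫ t in (0 : ℝ)..T, g (X t.toNNReal ω)) ∂P
      = ∫ t in (0 : ℝ)..T, ∫ ω, g (X t.toNNReal ω) ∂P := fun T hT => by
    simp only [intervalIntegral.integral_of_le hT.le]
    refine integral_integral_swap ?_
    have hm : Measurable fun z : Ω × ℝ => g (X z.2.toNNReal z.1) :=
      (measurable_uncurry_of_rightCts hXm hX.rightCts g).comp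
        (f := fun z : Ω × ℝ => (z.2.toNNReal, z.1))
        ((measurable_real_toNNReal.comp measurable_snd).prodMk measurable_fst)
    exact Integrable.of_bound hm.aestronglyMeasurable M'
      (ae_of_all _ fun z => (Real.norm_eq_abs _).trans_le (hg _))
  have hmain : ∀ T : ℝ, 0 < T → |1 / T * ∫ ω, (∫ t in (0 : ℝ)..T, g (X t.toNNReal ω)) ∂P - c|
      ≤ 2 * M / T := fun T hT => by
    have hD := hp.integral_sub_eq_integral_jumpGenerator hr hR hμ hadd hf T.toNNReal
    simp only [hGf, Real.coe_toNNReal _ hT.le] at hD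
    rw [intervalIntegral.integral_sub (hcont.intervalIntegrable _ _) (by simp)] at hD
    simp only [intervalIntegral.integral_const, sub_zero, smul_eq_mul] at hD
    rw [hswap T hT, show 1 / T * (∫ t in (0 : ℝ)..T, ∫ ω, g (X t.toNNReal ω) ∂P) - c
      = ((∫ t in (0 : ℝ)..T, ∫ ω, g (X t.toNNReal ω) ∂P) - T * c) / T by field_simp, hD,
      abs_div, abs_of_pos hT]
    refine div_le_div_of_nonneg_right ((abs_sub _ _).trans ?_) hT.le
    have h1 := abs_integral_le_of_abs_le hf (μ T.toNNReal)
    have h2 := abs_integral_le_of_abs_le hf (μ 0)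
    linarith
  rw [tendsto_iff_norm_sub_tendsto_zero]
  refine squeeze_zero' (Eventually.of_forall fun _ => norm_nonneg _) ?_
    ((tendsto_const_nhds (x := 2 * M)).div_atTop tendsto_id)
  filter_upwards [eventually_gt_atTop 0] with T hT
  exact hmain T hT

end LongRunAverage

/-! ### Fresh clusterheads and fresh end-nodes -/

namespace Versions

variable {m k : ℕ}

theorem Consistent.sourceUpdate {x : Versions m k} (hx : x.Consistent) :
    x.sourceUpdate.Consistent :=
  ⟨fun j => (hx.1 j).trans (Nat.le_succ _), hx.2⟩

theorem Consistent.headUpdate {x : Versions m k} (hx : x.Consistent) (j : Fin m) :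
    (x.headUpdate j).Consistent := by
  refine ⟨fun l => ?_, fun l i => ?_⟩ <;>
    simp only [Versions.headUpdate, Function.update_apply] <;> split_ifs with h
  · exact le_rfl
  · exact hx.1 l
  · exact (hx.2 l i).trans (hx.1 l)
  · exact hx.2 l i

theorem Consistent.nodeUpdate {x : Versions m k} (hx : x.Consistent) (j : Fin m) (i : Fin k) :
    (x.nodeUpdate j i).Consistent := by
  refine ⟨hx.1, fun l a => ?_⟩
  simp only [Versions.nodeUpdate, Function.update_apply]
  split_ifs with h
  · subst h
    rw [Function.update_apply]
    split_ifs
    exacts [le_rfl, hx.2 _ _]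
  · exact hx.2 l a

/-- The clusterheads that hold the version of the source. -/
def freshHeads (x : Versions m k) : Finset (Fin m) :=
  Finset.univ.filter fun l => x.head l = x.source

/-- The end-nodes of cluster `j` that hold the version of the source. -/
def freshNodes (j : Fin m) (x : Versions m k) : Finset (Fin k) :=
  Finset.univ.filter fun l => x.node j l = x.source

@[simp]
theorem mem_freshHeads {x : Versions m k} {l : Fin m} :
    l ∈ x.freshHeads ↔ x.head l = x.source := by
  simp [freshHeads]

@[simp]
theorem mem_freshNodes {j : Fin m} {x : Versions m k} {l : Fin k} :
    l ∈ x.freshNodes j ↔ x.node j l = x.source := by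
  simp [freshNodes]

theorem freshHeads_sourceUpdate {x : Versions m k} (hx : x.Consistent) :
    x.sourceUpdate.freshHeads = ∅ :=
  Finset.filter_false_of_mem fun l _ => ((hx.1 l).trans_lt (Nat.lt_succ_self _)).ne

theorem freshHeads_headUpdate (j : Fin m) (x : Versions m k) :
    (x.headUpdate j).freshHeads = insert j x.freshHeads := by
  ext l
  by_cases h : l = j <;> simp [headUpdate, h]

theorem freshHeads_nodeUpdate (j : Fin m) (i : Fin k) (x : Versions m k) :
    (x.nodeUpdate j i).freshHeads = x.freshHeads := rfl

theorem freshNodes_sourceUpdate {x : Versions m k} (hx : x.Consistent) (j : Fin m) :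
    x.sourceUpdate.freshNodes j = ∅ :=
  Finset.filter_false_of_mem fun l _ =>
    (((hx.2 j l).trans (hx.1 j)).trans_lt (Nat.lt_succ_self _)).ne

theorem freshNodes_headUpdate (j j' : Fin m) (x : Versions m k) :
    (x.headUpdate j').freshNodes j = x.freshNodes j := rfl

theorem freshNodes_nodeUpdate_of_ne {j j' : Fin m} (h : j ≠ j') (i : Fin k) (x : Versions m k) :
    (x.nodeUpdate j' i).freshNodes j = x.freshNodes j := by
  ext l
  simp [nodeUpdate, h]

theorem freshNodes_nodeUpdate_of_fresh {j : Fin m} {x : Versions m k} (h : x.head j = x.source)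
    (i : Fin k) : (x.nodeUpdate j i).freshNodes j = insert i (x.freshNodes j) := by
  ext l
  by_cases h' : l = i <;> simp [nodeUpdate, h, h']

/-- All end-nodes of a stale clusterhead are stale. -/
theorem freshNodes_eq_empty {j : Fin m} {x : Versions m k} (hx : x.Consistent)
    (h : x.head j ≠ x.source) : x.freshNodes j = ∅ :=
  Finset.filter_false_of_mem fun l _ => ((hx.2 j l).trans_lt ((hx.1 j).lt_of_ne h)).ne

end Versions

/-! ### The generator of a clustered network -/

section Network

open Versions

variable {m k : ℕ}

/-- The kinds of jump of the version process: the self-update of the source, the update of a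
clusterhead, and the update of an end-node of a cluster. -/
abbrev Jump (m k : ℕ) : Type := Unit ⊕ Fin m ⊕ Fin m × Fin k

/-- The effect of a jump on the versions held in the network. -/
def jumpMap : Jump m k → Versions m k → Versions m k
  | .inl _, x => x.sourceUpdate
  | .inr (.inl j), x => x.headUpdate j
  | .inr (.inr (j, i)), x => x.nodeUpdate j i

/-- The rate of a jump. -/
noncomputable def jumpRate (modeS modeC : Mode) (lamE lamS lamC : ℝ) :
    Jump m k → Versions m k → ℝ
  | .inl _, _ => lamE
  | .inr (.inl j), x => linkRate modeS lamS (fun l => x.head l = x.source) j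
  | .inr (.inr (j, i)), x => linkRate modeC lamC (fun l => x.node j l = x.source) i

theorem transitionRate_eq_sum (modeS modeC : Mode) (lamE lamS lamC : ℝ) :
    transitionRate (m := m) (k := k) modeS modeC lamE lamS lamC = fun x y =>
      ∑ a, jumpRate modeS modeC lamE lamS lamC a x * (delta (jumpMap a x) y - delta x y) := by
  funext x y
  simp only [transitionRate, Fintype.sum_sum_type, Fintype.sum_prod_type, jumpRate, jumpMap,
    Finset.univ_unique, Finset.sum_singleton, add_assoc]

theorem jumpRate_nonneg (modeS modeC : Mode) {lamE lamS lamC : ℝ} (hE : 0 ≤ lamE) (hS : 0 ≤ lamS)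
    (hC : 0 ≤ lamC) (a : Jump m k) (x : Versions m k) :
    0 ≤ jumpRate modeS modeC lamE lamS lamC a x := by
  rcases a with _ | j | ⟨j, i⟩
  exacts [hE, linkRate_nonneg _ hS (fun l => x.head l = x.source) j,
    linkRate_nonneg _ hC (fun l => x.node j l = x.source) i]

theorem abs_jumpRate_le (modeS modeC : Mode) {lamE lamS lamC : ℝ} (hE : 0 ≤ lamE) (hS : 0 ≤ lamS)
    (hC : 0 ≤ lamC) (a : Jump m k) (x : Versions m k) :
    |jumpRate modeS modeC lamE lamS lamC a x| ≤ lamE + lamS + lamC := by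
  rw [abs_of_nonneg (jumpRate_nonneg _ _ hE hS hC a x)]
  rcases a with _ | j | ⟨j, i⟩ <;> simp only [jumpRate]
  · linarith
  · linarith [linkRate_le modeS hS (fun l => x.head l = x.source) j]
  · linarith [linkRate_le modeC hC (fun l => x.node j l = x.source) i]

theorem Versions.Consistent.jumpMap {x : Versions m k} (hx : x.Consistent) (a : Jump m k) :
    (GossipNetwork.jumpMap a x).Consistent := by
  rcases a with _ | _ | ⟨_, _⟩
  exacts [hx.sourceUpdate, hx.headUpdate _, hx.nodeUpdate _ _]

theorem linkRate_filter {r : ℕ} (mode : Mode) (rate : ℝ) (fresh : Fin r → Prop)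
    [DecidablePred fresh] (a : Fin r) :
    linkRate mode rate (· ∈ Finset.univ.filter fresh) a = linkRate mode rate fresh a := by
  cases mode <;> simp [linkRate]

variable (modeS modeC : Mode) (lamE lamS lamC : ℝ)

theorem jumpGenerator_freshHeads {x : Versions m k} (hx : x.Consistent)
    (f : Finset (Fin m) → ℝ) :
    jumpGenerator (jumpRate modeS modeC lamE lamS lamC) jumpMap (fun x => f x.freshHeads) x
      = layerGenerator modeS lamE lamS f x.freshHeads := by
  simp only [jumpGenerator, layerGenerator, Fintype.sum_sum_type, jumpRate,
    jumpMap, Finset.univ_unique, Finset.sum_singleton, freshHeads_sourceUpdate hx,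
    freshHeads_headUpdate, freshHeads_nodeUpdate, sub_self, mul_zero, Finset.sum_const_zero,
    add_zero]
  congr 1
  refine Finset.sum_congr rfl fun l _ => ?_
  rw [freshHeads, linkRate_filter]

theorem jumpGenerator_freshNodes {x : Versions m k} (hx : x.Consistent) (j : Fin m)
    (f : Finset (Fin k) → ℝ) :
    jumpGenerator (jumpRate modeS modeC lamE lamS lamC) jumpMap (fun x => f (x.freshNodes j)) x
      = if j ∈ x.freshHeads then layerGenerator modeC lamE lamC f (x.freshNodes j) else 0 := by
  simp only [jumpGenerator, layerGenerator, Fintype.sum_sum_type, Fintype.sum_prod_type, jumpRate,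
    jumpMap, Finset.univ_unique, Finset.sum_singleton, freshNodes_sourceUpdate hx,
    freshNodes_headUpdate, sub_self, mul_zero, Finset.sum_const_zero, zero_add]
  rw [Finset.sum_eq_single j (fun l _ hl => Finset.sum_eq_zero fun i _ => by
    rw [freshNodes_nodeUpdate_of_ne hl.symm, sub_self, mul_zero]) (by simp)]
  by_cases h : x.head j = x.source
  · rw [if_pos (mem_freshHeads.2 h)]
    congr 1
    refine Finset.sum_congr rfl fun l _ => ?_
    rw [freshNodes_nodeUpdate_of_fresh h, freshNodes, linkRate_filter]
  · rw [if_neg (mt mem_freshHeads.1 h), freshNodes_eq_empty hx h, sub_self, mul_zero,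
      zero_add]
    refine Finset.sum_eq_zero fun i _ => ?_
    rw [freshNodes_eq_empty (hx.nodeUpdate j i) h, sub_self, mul_zero]

variable {modeS modeC lamE lamS lamC}

/-- The long-term average freshness of an end-node is the product of the freshness of a receiver
of the source and the freshness that the end-node would have if its clusterhead were always
fresh. -/
theorem averageFreshness_eq {Ω : Type*} [mΩ : MeasurableSpace Ω] {P : Measure Ω}
    [IsProbabilityMeasure P] {ℱ : Filtration ℝ≥0 mΩ} (hE : 0 < lamE) (hS : 0 < lamS)
    (hC : 0 < lamC) {X : ℝ≥0 → Ω → Versions m k}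
    (hX : IsClusteredNetwork P ℱ modeS modeC lamE lamS lamC X) (j : Fin m) (i : Fin k) :
    averageFreshness P X j i
      = layerFreshness modeS lamE lamS m * layerFreshness modeC lamE lamC k := by
  obtain ⟨fS, hfS⟩ := exists_layerGenerator_eq modeS hE hS j
  obtain ⟨fC, hfC⟩ := exists_layerGenerator_eq modeC hE hC i
  set c := layerFreshness modeC lamE lamC k
  have hchain := hX.chain
  rw [transitionRate_eq_sum] at hchain
  let F : Finset (Fin k) × Finset (Fin m) → ℝ := fun z => fC z.1 + c * fS z.2
  obtain ⟨M, hM⟩ := (Set.finite_range fun z => |F z|).bddAbove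
  refine (tendsto_average_of_jumpGenerator_eq (jumpRate_nonneg modeS modeC hE.le hS.le hC.le)
    (abs_jumpRate_le modeS modeC hE.le hS.le hC.le) hchain (C := {x | x.Consistent})
    (fun a x hx => hx.jumpMap a) hX.init (f := fun x => F (x.freshNodes j, x.freshHeads))
    (g := fun x => x.freshness j i) (fun x => hM ⟨_, rfl⟩) (M' := 1) (fun x => ?_)
    (fun x hx => ?_)).limsup_eq
  · unfold freshness
    split_ifs <;> simp
  · have hadd : jumpGenerator (jumpRate modeS modeC lamE lamS lamC) jumpMap
        (fun x => F (x.freshNodes j, x.freshHeads)) x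
        = jumpGenerator (jumpRate modeS modeC lamE lamS lamC) jumpMap
            (fun x => fC (x.freshNodes j)) x
          + c * jumpGenerator (jumpRate modeS modeC lamE lamS lamC) jumpMap
            (fun x => fS x.freshHeads) x := by
      simp only [jumpGenerator, Finset.mul_sum, ← Finset.sum_add_distrib, F]
      exact Finset.sum_congr rfl fun a _ => by ring
    have hfresh : x.freshness j i = if i ∈ x.freshNodes j then 1 else 0 := by
      simp [freshness]
    rw [hadd, jumpGenerator_freshNodes _ _ _ _ _ hx, jumpGenerator_freshHeads _ _ _ _ _ hx, hfS,
      hfC, hfresh]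
    by_cases h : j ∈ x.freshHeads
    · simp only [h, if_true]
      ring
    -- A stale clusterhead has only stale end-nodes, so only the source layer contributes.
    · simp only [h, freshNodes_eq_empty hx (mt mem_freshHeads.2 h), Finset.notMem_empty, if_false]
      ring

end Network

end GossipNetwork

theorem mainTheorem3 {Ω : Type*} [mΩ : MeasurableSpace Ω] (P : Measure Ω)
    [IsProbabilityMeasure P] (ℱ : Filtration ℝ≥0 mΩ)
    (n m k : ℕ) (hk : 0 < k) (hn : 0 < n) (hm : (m : ℝ) = n / k)
    (lamE lamS lamC : ℝ) (hE : 0 < lamE) (hS : 0 < lamS) (hC : 0 < lamC)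
    (X : ℝ≥0 → Ω → GossipNetwork.Versions m k) (j : Fin m) (i : Fin k) :
    (GossipNetwork.IsClusteredNetwork P ℱ .noRC .noRC lamE lamS lamC X →
      GossipNetwork.averageFreshness P X j i
        = lamS / (lamS + m * lamE) * (lamC / (lamC + k * lamE))) ∧
    (GossipNetwork.IsClusteredNetwork P ℱ .noRC .RC lamE lamS lamC X →
      GossipNetwork.averageFreshness P X j i
        = lamS / (lamS + m * lamE)
          * (lamC / (k * lamE) * (1 - (lamC / (lamC + lamE)) ^ k))) ∧
    (GossipNetwork.IsClusteredNetwork P ℱ .RC .noRC lamE lamS lamC X →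
      GossipNetwork.averageFreshness P X j i
        = 1 / m * (lamS / lamE) * (1 - (lamS / (lamS + lamE)) ^ m)
          * (lamC / (lamC + k * lamE))) ∧
    (GossipNetwork.IsClusteredNetwork P ℱ .RC .RC lamE lamS lamC X →
      GossipNetwork.averageFreshness P X j i
        = (1 / m * (lamS / lamE) * (1 - (lamS / (lamS + lamE)) ^ m))
          * (lamC / (k * lamE) * (1 - (lamC / (lamC + lamE)) ^ k))) := by
  refine ⟨fun h => ?_, fun h => ?_, fun h => ?_, fun h => ?_⟩ <;>
    rw [GossipNetwork.averageFreshness_eq hE hS hC h] <;>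
    simp only [GossipNetwork.layerFreshness]
  · rw [div_mul_div_comm, one_mul]
  · ring
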